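/- For $\beta>0$ let $\mathbb{Q}^{(\beta)}=(\mathbb{Q}^{(\beta)}_t)_{t\ge 0}$ be the semi-group $\mathbb{Q}^{(\beta)}_t g(n)=\mathbb{E}_n[g(\mathbb{X}_t)]$ of the linear birth-death process $\mathbb{X}$ on $\mathbb{Z}_+=\{0,1,2,\dots\}$, that is, of the continuous-time Markov chain with generator $$\mathbb{G}_\beta g(n)=(n+\beta)\,(g(n+1)-g(n))+n\,(g(n-1)-g(n)).$$ For $\alpha,\beta>0$ let $B(\beta,\alpha)$ be a beta variable with density $\frac{\Gamma(\alpha+\beta)}{\Gamma(\alpha)\Gamma(\beta)}r^{\beta-1}(1-r)^{\alpha-1}$ on $(0,1)$, and define the discrete beta kernel by $$\mathbb{B}_{\beta,\alpha}g(n)=\sum_{m=0}^n g(m)\binom{n}{m}\,\mathbb{E}\big[B(\beta,\alpha)^m(1-B(\beta,\alpha))^{n-m}\big],\qquad n\in\mathbb{Z}_+.$$ Let $\mathbf{c}_0(\mathbb{Z}_+)$ be the space of real functions on $\mathbb{Z}_+$ vanishing at infinity. For a $\mathbb{Z}_+$-valued variable $X$ and $p\in[0,1]$ let $p\odot X=\sum_{i=1}^X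 b_i(p)$, where $(b_i(p))_{i\ge1}$ are i.i.d. Bernoulli variables of parameter $p$, independent of $X$. For a random factor $B$ in $[0,1]$ independent of $X$, the conditional law of $B\odot X$ given $B=p$ is the law of $p\odot X$. For $a>0$ let $\mathrm{Pois}(\mathrm{Gam}(a))$ denote a variable which, given a standard gamma variable $\mathrm{Gam}(a)$ of shape $a$ (and scale $1$), is Poisson with parameter $\mathrm{Gam}(a)$. Then, for all $\alpha,\beta,t>0$, the operators $\mathbb{B}_{\beta,\alpha}$, $\mathbb{Q}^{(\alpha+\beta)}_t$ and $\mathbb{Q}^{(\beta)}_t$ map $\mathbf{c}_0(\mathbb{Z}_+)$ into itself, and on $\mathbf{c}_0(\mathbb{Z}_+)$ $$\mathbb{Q}^{(\alpha+\beta)}_t\,\mathbb{B}_{\beta,\alpha}=\mathbb{B}_{\beta,\alpha}\,\mathbb{Q}^{(\beta)}_t .$$ Moreover, with $B(\beta,\alpha)$ independent of $\mathrm{Pois}(\mathrm{Gam}(\alpha+\beta))$, $$B(\beta,\alpha)\odot\mathrm{Pois}(\mathrm{Gam}(\alpha+\beta))\overset{(d)}{=}\mathrm{Pois}(\mathrm{Gam}(\beta)).$$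 -/

import Mathlib

open MeasureTheory ProbabilityTheory Filter Topology
open scoped ENNReal ZeroAtInfty

noncomputable section

/-! ### Transition function of a continuous-time Markov chain on `ℕ` -/

/-- `minimalTransitionAux q k t m n` is the probability that the continuous-time Markov chain with
`Q`-matrix `q`, started at `m`, is at `n` at time `t` after fewer than `k` jumps. It is given by
conditioning on the first jump: the chain stays at `m` for an exponential time of parameter
`-q m m`, and then jumps to `j ≠ m` with probability proportional to `q m j`. -/
def minimalTransitionAux (q : ℕ → ℕ → ℝ) : ℕ → ℝ → ℕ → ℕ → ℝ≥0∞
  | 0, _, _, _ => 0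
  | k + 1, t, m, n =>
      (if m = n then ENNReal.ofReal (Real.exp (q m m * t)) else 0) +
        ∫⁻ s in Set.Icc 0 t, ENNReal.ofReal (Real.exp (q m m * s)) *
          ∑' j, if j = m then 0 else
            ENNReal.ofReal (q m j) * minimalTransitionAux q k (t - s) j n

/-- The (minimal) transition function of the continuous-time Markov chain on `ℕ` with
`Q`-matrix `q`. -/
def minimalTransition (q : ℕ → ℕ → ℝ) (t : ℝ) (m n : ℕ) : ℝ≥0∞ :=
  ⨆ k, minimalTransitionAux q k t m n

/-! ### The linear birth-death process -/

/-- The difference operator `(n + β) ∂₊ + n ∂₋`, with `∂± g(n) = g(n ± 1) - g(n)`. At `n = 0` the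
second term has coefficient `0`. -/
def birthDeathGenerator (β : ℝ) (g : ℕ → ℝ) (n : ℕ) : ℝ :=
  (n + β) * (g (n + 1) - g n) + n * (g (n - 1) - g n)

/-- The `Q`-matrix of the linear birth-death process: the generator applied to the indicator
function of `{n}`, evaluated at `m`. -/
def birthDeathMatrix (β : ℝ) (m n : ℕ) : ℝ :=
  birthDeathGenerator β (Pi.single n 1) m

/-- The transition function of the linear birth-death process. -/
def birthDeathTransition (β t : ℝ) (m n : ℕ) : ℝ≥0∞ :=
  minimalTransition (birthDeathMatrix β) t m n

lemma minimalTransitionAux_mono (q : ℕ → ℕ → ℝ) (t : ℝ) (m n : ℕ) :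
    Monotone fun k => minimalTransitionAux q k t m n := by
  refine monotone_nat_of_le_succ fun k => ?_
  induction k generalizing t m with
  | zero => simp [minimalTransitionAux]
  | succ k ih =>
    rw [minimalTransitionAux, minimalTransitionAux]
    refine add_le_add le_rfl (lintegral_mono fun s => mul_le_mul_right
      (ENNReal.tsum_le_tsum fun j => ?_) _)
    split_ifs
    · exact le_rfl
    · exact mul_le_mul_right (ih _ _) _

lemma birthDeathMatrix_self (β : ℝ) (m : ℕ) : birthDeathMatrix β m m = -(2 * m + β) := by
  rcases m with _ | m <;> simp [birthDeathMatrix, birthDeathGenerator]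
  ring

lemma birthDeathMatrix_tsum (β : ℝ) (m : ℕ) (u : ℕ → ℝ≥0∞) :
    (∑' j, if j = m then 0 else ENNReal.ofReal (birthDeathMatrix β m j) * u j) =
      ENNReal.ofReal (m + β) * u (m + 1) + ENNReal.ofReal m * u (m - 1) := by
  rcases m with _ | m
  · rw [tsum_eq_single 1]
    · simp [birthDeathMatrix, birthDeathGenerator]
    · intro j hj
      by_cases h : j = 0
      · simp [h]
      · simp [birthDeathMatrix, birthDeathGenerator, h, hj.symm, Ne.symm h]
  · rw [tsum_eq_sum (s := {m + 2, m})]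
    · rw [Finset.sum_pair (by omega)]
      have h : m + 1 + 1 ≠ m := by omega
      simp [birthDeathMatrix, birthDeathGenerator, h]
    · intro j hj
      simp only [Finset.mem_insert, Finset.mem_singleton, not_or] at hj
      by_cases h : j = m + 1
      · simp [h]
      · simp [birthDeathMatrix, birthDeathGenerator, h, Ne.symm h,
          Ne.symm hj.1, Ne.symm hj.2]

lemma sum_lintegral_le (F : Finset ℕ) (S : Set ℝ) (f : ℕ → ℝ → ℝ≥0∞) :
    ∑ n ∈ F, ∫⁻ s in S, f n s ≤ ∫⁻ s in S, ∑ n ∈ F, f n s := by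
  induction F using Finset.induction_on with
  | empty => simp
  | insert a F ha ih =>
    simp only [Finset.sum_insert ha]
    exact (add_le_add le_rfl ih).trans (le_lintegral_add _ _)

lemma exp_add_lintegral {c t : ℝ} (hc : 0 ≤ c) (ht : 0 ≤ t) :
    ENNReal.ofReal (Real.exp (-c * t)) +
      ∫⁻ s in Set.Icc 0 t, ENNReal.ofReal (Real.exp (-c * s)) * ENNReal.ofReal c = 1 := by
  have h1 : ∀ s : ℝ, HasDerivAt (fun s => -Real.exp (-c * s)) (Real.exp (-c * s) * c) s := by
    intro s
    exact (((hasDerivAt_id' s).const_mul (-c)).exp).neg.congr_deriv (by ring)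
  have h2 : ∫ s in (0 : ℝ)..t, Real.exp (-c * s) * c = 1 - Real.exp (-c * t) := by
    rw [intervalIntegral.integral_eq_sub_of_hasDerivAt (fun s _ => h1 s)
      (Continuous.intervalIntegrable (by fun_prop) _ _)]
    simp
    ring
  have h3 : ∫⁻ s in Set.Icc 0 t, ENNReal.ofReal (Real.exp (-c * s)) * ENNReal.ofReal c =
      ENNReal.ofReal (1 - Real.exp (-c * t)) := by
    rw [← h2, intervalIntegral.integral_of_le ht, ← integral_Icc_eq_integral_Ioc,
      ofReal_integral_eq_lintegral_ofReal]
    · simp only [ENNReal.ofReal_mul (Real.exp_nonneg _)]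
    · exact (Continuous.continuousOn (by fun_prop)).integrableOn_Icc
    · exact ae_of_all _ fun s => by positivity
  rw [h3, ← ENNReal.ofReal_add (Real.exp_nonneg _)]
  · simp
  · rw [sub_nonneg, Real.exp_le_one_iff]
    nlinarith [mul_nonneg hc ht]

lemma sum_minimalTransitionAux_le {β : ℝ} (hβ : 0 ≤ β) (F : Finset ℕ) (k : ℕ) :
    ∀ t : ℝ, 0 ≤ t → ∀ m,
      ∑ n ∈ F, minimalTransitionAux (birthDeathMatrix β) k t m n ≤ 1 := by
  induction k with
  | zero => intro t _ m; simp [minimalTransitionAux]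
  | succ k ih =>
    intro t ht m
    simp only [minimalTransitionAux, birthDeathMatrix_tsum β, birthDeathMatrix_self]
    rw [Finset.sum_add_distrib, ← exp_add_lintegral (c := 2 * m + β) (by positivity) ht]
    gcongr
    · rw [Finset.sum_ite_eq]
      split_ifs <;> simp
    · refine (sum_lintegral_le F _ _).trans (setLIntegral_mono' measurableSet_Icc fun s hs => ?_)
      rw [← Finset.mul_sum, Finset.sum_add_distrib, ← Finset.mul_sum, ← Finset.mul_sum]
      gcongr
      have hts : 0 ≤ t - s := sub_nonneg.2 hs.2
      calc _ ≤ ENNReal.ofReal (m + β) * 1 + ENNReal.ofReal m * 1 := by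
            gcongr
            · exact ih _ hts _
            · exact ih _ hts _
        _ = _ := by
            rw [mul_one, mul_one, ← ENNReal.ofReal_add (by positivity) (by positivity)]
            congr 1; ring

/-- The transition function is sub-Markovian, so that the series defining the semi-group converges
absolutely on bounded functions. -/
theorem tsum_birthDeathTransition_le_one {β t : ℝ} (hβ : 0 ≤ β) (ht : 0 ≤ t) (m : ℕ) :
    ∑' n, birthDeathTransition β t m n ≤ 1 := by
  rw [ENNReal.tsum_eq_iSup_sum]
  refine iSup_le fun F => ?_
  simp only [birthDeathTransition, minimalTransition]
  rw [ENNReal.finsetSum_iSup_of_monotone fun n => minimalTransitionAux_mono _ t m n]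
  exact iSup_le fun k => sum_minimalTransitionAux_le hβ F k t ht m

/-- The semi-group of the linear birth-death process, `g ↦ (m ↦ 𝔼ₘ[g(Xₜ)])`. -/
def birthDeathSemigroup (β t : ℝ) (g : ℕ → ℝ) (m : ℕ) : ℝ :=
  ∑' n, (birthDeathTransition β t m n).toReal * g n

/-! ### Thinning -/

/-- The discrete beta kernel
`g ↦ (n ↦ ∑ m ≤ n, g(m) * binom(n, m) * 𝔼[B ^ m * (1 - B) ^ (n - m)])`,
where `B` has the beta distribution with density proportional to `r ^ (β - 1) * (1 - r) ^ (α - 1)`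
on `(0, 1)`. -/
def discreteBetaKernel (β α : ℝ) (g : ℕ → ℝ) (n : ℕ) : ℝ :=
  ∑ m ∈ Finset.range (n + 1),
    g m * (n.choose m) * ∫ r, r ^ m * (1 - r) ^ (n - m) ∂(betaMeasure β α)

/-- The binomial thinning `p ⊙ X`: the law of `∑ i < X, b i`, where `X` has law `ν` and `b` is a
sequence of i.i.d. Bernoulli variables of parameter `p`, independent of `X`. -/
def thinningLaw (p : unitInterval) (ν : Measure ℕ) : Measure ℕ :=
  (ν.prod (Measure.infinitePi fun _ : ℕ => bernoulliMeasure (1 : ℕ) 0 p)).map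
    fun x => ∑ i ∈ Finset.range x.1, x.2 i

/-- The law of the binomial thinning `B ⊙ X` with a random factor `B` of law `ρ` on `[0, 1]`,
independent of `X` of law `ν`: given `B = p` it is the law of `p ⊙ X`. -/
def randomThinningLaw (ρ : Measure ℝ) (ν : Measure ℕ) : Measure ℕ :=
  ρ.bind fun p => thinningLaw (Set.projIcc 0 1 zero_le_one p) ν

/-- The law of `Pois(Gam(a))`, a Poisson variable whose parameter is an independent standard gamma
variable of shape `a`. -/
def poissonGammaLaw (a : ℝ) : Measure ℕ :=
  (gammaMeasure a 1).bind fun x => poissonMeasure x.toNNReal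

end

/-! ### The backward equation -/

lemma measurable_minimalTransitionAux (q : ℕ → ℕ → ℝ) (k m n : ℕ) :
    Measurable fun t => minimalTransitionAux q k t m n := by
  induction k generalizing m with
  | zero => simp only [minimalTransitionAux]; fun_prop
  | succ k ih =>
    simp only [minimalTransitionAux]
    refine Measurable.add ?_ ?_
    · split_ifs <;> fun_prop
    · simp_rw [← lintegral_indicator measurableSet_Icc]
      refine Measurable.lintegral_prod_right' (f := fun p : ℝ × ℝ => (Set.Icc 0 p.1).indicator
        (fun s => ENNReal.ofReal (Real.exp (q m m * s)) *
          ∑' j, if j = m then 0 else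
            ENNReal.ofReal (q m j) * minimalTransitionAux q k (p.1 - s) j n) p.2) ?_
      have hs : MeasurableSet {p : ℝ × ℝ | 0 ≤ p.2 ∧ p.2 ≤ p.1} :=
        (measurableSet_le measurable_const measurable_snd).inter
          (measurableSet_le measurable_snd measurable_fst)
      have hf : Measurable fun p : ℝ × ℝ => ENNReal.ofReal (Real.exp (q m m * p.2)) *
          ∑' j, if j = m then 0 else
            ENNReal.ofReal (q m j) * minimalTransitionAux q k (p.1 - p.2) j n := by
        refine Measurable.mul (by fun_prop) (Measurable.tsum fun j => ?_)
        split_ifs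
        · fun_prop
        · exact ((ih j).comp (measurable_fst.sub measurable_snd)).const_mul _
      convert! hf.indicator hs using 2

lemma measurable_birthDeathTransition (β : ℝ) (m n : ℕ) :
    Measurable fun t => birthDeathTransition β t m n :=
  Measurable.iSup fun k => measurable_minimalTransitionAux _ k m n

lemma birthDeathTransition_eq (β t : ℝ) (m n : ℕ) :
    birthDeathTransition β t m n =
      (if m = n then ENNReal.ofReal (Real.exp (-(2 * m + β) * t)) else 0) +
        ∫⁻ s in Set.Icc 0 t, ENNReal.ofReal (Real.exp (-(2 * m + β) * s)) *
          (ENNReal.ofReal (m + β) * birthDeathTransition β (t - s) (m + 1) n +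
            ENNReal.ofReal m * birthDeathTransition β (t - s) (m - 1) n) := by
  have hmono := fun s j => minimalTransitionAux_mono (birthDeathMatrix β) s j n
  have hmeas : ∀ k j, Measurable fun s =>
      minimalTransitionAux (birthDeathMatrix β) k (t - s) j n := fun k j =>
    (measurable_minimalTransitionAux _ k j n).comp (measurable_const.sub measurable_id)
  rw [birthDeathTransition, minimalTransition, ← (hmono t m).iSup_nat_add 1]
  simp only [minimalTransitionAux, birthDeathMatrix_tsum, birthDeathMatrix_self]
  rw [← ENNReal.add_iSup, ← lintegral_iSup]
  · congr 1
    refine lintegral_congr fun s => ?_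
    rw [← ENNReal.mul_iSup]
    congr 1
    rw [← ENNReal.iSup_add_iSup_of_monotone, ← ENNReal.mul_iSup, ← ENNReal.mul_iSup]
    · rfl
    · exact fun i j h => mul_le_mul_right (hmono _ _ h) _
    · exact fun i j h => mul_le_mul_right (hmono _ _ h) _
  · exact fun k => Measurable.mul (by fun_prop)
      (((hmeas k _).const_mul _).add ((hmeas k _).const_mul _))
  · exact fun i j h s => mul_le_mul_right (add_le_add (mul_le_mul_right (hmono _ _ h) _)
      (mul_le_mul_right (hmono _ _ h) _)) _

/-- The semi-group of the linear birth-death process acting on `ℝ≥0∞`-valued functions. -/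
noncomputable def birthDeathLSemigroup (β : ℝ) (F : ℕ → ℝ≥0∞) (t : ℝ) (m : ℕ) : ℝ≥0∞ :=
  ∑' n, birthDeathTransition β t m n * F n

lemma measurable_birthDeathLSemigroup (β : ℝ) (F : ℕ → ℝ≥0∞) (m : ℕ) :
    Measurable fun t => birthDeathLSemigroup β F t m :=
  Measurable.tsum fun n => (measurable_birthDeathTransition β m n).mul_const _

lemma birthDeathLSemigroup_eq (β : ℝ) (F : ℕ → ℝ≥0∞) (t : ℝ) (m : ℕ) :
    birthDeathLSemigroup β F t m =
      ENNReal.ofReal (Real.exp (-(2 * m + β) * t)) * F m +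
        ∫⁻ s in Set.Icc 0 t, ENNReal.ofReal (Real.exp (-(2 * m + β) * s)) *
          (ENNReal.ofReal (m + β) * birthDeathLSemigroup β F (t - s) (m + 1) +
            ENNReal.ofReal m * birthDeathLSemigroup β F (t - s) (m - 1)) := by
  have hmeas : ∀ j n, Measurable fun s => birthDeathTransition β (t - s) j n := fun j n =>
    (measurable_birthDeathTransition β j n).comp (measurable_const.sub measurable_id)
  have hm : ∀ n, Measurable fun s => ENNReal.ofReal (Real.exp (-(2 * m + β) * s)) *
      (ENNReal.ofReal (m + β) * birthDeathTransition β (t - s) (m + 1) n +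
        ENNReal.ofReal m * birthDeathTransition β (t - s) (m - 1) n) := fun n =>
    Measurable.mul (by fun_prop) (((hmeas _ n).const_mul _).add ((hmeas _ n).const_mul _))
  conv_lhs => rw [birthDeathLSemigroup]
  simp_rw [birthDeathTransition_eq β t m, add_mul]
  rw [ENNReal.tsum_add]
  congr 1
  · rw [tsum_eq_single m]
    · simp
    · intro n hn
      simp [hn.symm]
  · simp_rw [← lintegral_mul_const _ (hm _)]
    rw [← lintegral_tsum fun n => ((hm n).mul_const _).aemeasurable]
    refine lintegral_congr fun s => ?_
    simp_rw [mul_assoc]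
    rw [ENNReal.tsum_mul_left]
    congr 1
    simp_rw [add_mul, mul_assoc]
    rw [ENNReal.tsum_add, ENNReal.tsum_mul_left, ENNReal.tsum_mul_left]
    rfl

lemma birthDeathLSemigroup_le {β t : ℝ} (hβ : 0 ≤ β) (ht : 0 ≤ t) {F : ℕ → ℝ≥0∞} {C : ℝ≥0∞}
    (hF : ∀ n, F n ≤ C) (m : ℕ) : birthDeathLSemigroup β F t m ≤ C := by
  calc birthDeathLSemigroup β F t m ≤ ∑' n, birthDeathTransition β t m n * C :=
        ENNReal.tsum_le_tsum fun n => mul_le_mul_right (hF n) _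
    _ ≤ 1 * C := by
        rw [ENNReal.tsum_mul_right]
        exact mul_le_mul_left (tsum_birthDeathTransition_le_one hβ ht m) _
    _ = C := one_mul C

lemma birthDeathTransition_ne_top {β t : ℝ} (hβ : 0 ≤ β) (ht : 0 ≤ t) (m n : ℕ) :
    birthDeathTransition β t m n ≠ ∞ :=
  ne_top_of_le_ne_top ENNReal.one_ne_top
    ((ENNReal.le_tsum n).trans (tsum_birthDeathTransition_le_one hβ ht m))

lemma birthDeathSemigroup_eq_toReal {β t : ℝ} (hβ : 0 ≤ β) (ht : 0 ≤ t) {f : ℕ → ℝ}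
    (hf : ∀ n, 0 ≤ f n) (m : ℕ) : birthDeathSemigroup β t f m =
      (birthDeathLSemigroup β (fun n => ENNReal.ofReal (f n)) t m).toReal := by
  rw [birthDeathLSemigroup, ENNReal.tsum_toReal_eq fun n =>
    ENNReal.mul_ne_top (birthDeathTransition_ne_top hβ ht m n) ENNReal.ofReal_ne_top]
  simp [birthDeathSemigroup, ENNReal.toReal_ofReal (hf _)]

lemma summable_birthDeathTransition_mul {β t : ℝ} (hβ : 0 ≤ β) (ht : 0 ≤ t) {f : ℕ → ℝ} {C : ℝ}
    (hf : ∀ n, |f n| ≤ C) (m : ℕ) :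
    Summable fun n => (birthDeathTransition β t m n).toReal * f n := by
  have h : Summable fun n => (birthDeathTransition β t m n).toReal :=
    ENNReal.summable_toReal
      (ne_top_of_le_ne_top ENNReal.one_ne_top (tsum_birthDeathTransition_le_one hβ ht m))
  refine Summable.of_norm_bounded (h.mul_right C) fun n => ?_
  rw [norm_mul, Real.norm_of_nonneg ENNReal.toReal_nonneg]
  exact mul_le_mul_of_nonneg_left (hf n) ENNReal.toReal_nonneg

lemma abs_birthDeathSemigroup_le {β t : ℝ} (hβ : 0 ≤ β) (ht : 0 ≤ t) {f : ℕ → ℝ} {C : ℝ}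
    (hf : ∀ n, |f n| ≤ C) (m : ℕ) : |birthDeathSemigroup β t f m| ≤ C := by
  have hC : 0 ≤ C := (abs_nonneg _).trans (hf 0)
  have h0 := summable_birthDeathTransition_mul hβ ht (f := fun n => |f n|) (C := C) (by simpa) m
  have h1 : |birthDeathSemigroup β t f m| ≤ birthDeathSemigroup β t (fun n => |f n|) m := by
    rw [← Real.norm_eq_abs]
    refine tsum_of_norm_bounded h0.hasSum fun n => ?_
    rw [norm_mul, Real.norm_of_nonneg ENNReal.toReal_nonneg, Real.norm_eq_abs]
  refine h1.trans ?_
  rw [birthDeathSemigroup_eq_toReal hβ ht (fun n => abs_nonneg _)]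
  exact ENNReal.toReal_le_of_le_ofReal hC
    (birthDeathLSemigroup_le hβ ht (fun n => ENNReal.ofReal_le_ofReal (hf n)) m)

lemma birthDeathSemigroup_sub {β t : ℝ} (hβ : 0 ≤ β) (ht : 0 ≤ t) {f g : ℕ → ℝ} {C D : ℝ}
    (hf : ∀ n, |f n| ≤ C) (hg : ∀ n, |g n| ≤ D) (m : ℕ) :
    birthDeathSemigroup β t (f - g) m =
      birthDeathSemigroup β t f m - birthDeathSemigroup β t g m := by
  rw [birthDeathSemigroup, birthDeathSemigroup, birthDeathSemigroup,
    ← (summable_birthDeathTransition_mul hβ ht hf m).tsum_sub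
      (summable_birthDeathTransition_mul hβ ht hg m)]
  simp [mul_sub]

/-- Bounded classical solutions of the backward equation `∂ₜ u = 𝔾_β u`, `u(0, ·) = f`. -/
structure IsBackwardSolution (β : ℝ) (f : ℕ → ℝ) (u : ℝ → ℕ → ℝ) : Prop where
  bounded : ∃ C, ∀ t, 0 ≤ t → ∀ m, |u t m| ≤ C
  continuousOn : ∀ m, ContinuousOn (fun t => u t m) (Set.Ici 0)
  initial : ∀ m, u 0 m = f m
  hasDerivAt : ∀ t, 0 < t → ∀ m, HasDerivAt (fun t => u t m) (birthDeathGenerator β (u t) m) t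

lemma IsBackwardSolution.sub {β : ℝ} {f g : ℕ → ℝ} {u v : ℝ → ℕ → ℝ}
    (hu : IsBackwardSolution β f u) (hv : IsBackwardSolution β g v) :
    IsBackwardSolution β (f - g) fun t m => u t m - v t m where
  bounded := by
    obtain ⟨C, hC⟩ := hu.bounded
    obtain ⟨D, hD⟩ := hv.bounded
    exact ⟨C + D, fun t ht m => (abs_sub _ _).trans (add_le_add (hC t ht m) (hD t ht m))⟩
  continuousOn m := (hu.continuousOn m).sub (hv.continuousOn m)
  initial m := by simp [hu.initial, hv.initial]
  hasDerivAt t ht m := ((hu.hasDerivAt t ht m).sub (hv.hasDerivAt t ht m)).congr_deriv (by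
    simp only [birthDeathGenerator]; ring)

lemma birthDeathSemigroup_eq_integral {β t : ℝ} (hβ : 0 ≤ β) (ht : 0 ≤ t) {f : ℕ → ℝ} {C : ℝ}
    (hf : ∀ n, 0 ≤ f n) (hC : ∀ n, |f n| ≤ C) (m : ℕ) :
    birthDeathSemigroup β t f m = Real.exp (-(2 * m + β) * t) * (f m +
      ∫ r in (0 : ℝ)..t, Real.exp ((2 * m + β) * r) *
        ((m + β) * birthDeathSemigroup β r f (m + 1) +
          m * birthDeathSemigroup β r f (m - 1))) := by
  set F : ℕ → ℝ≥0∞ := fun n => ENNReal.ofReal (f n) with hF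
  have hFC : ∀ n, F n ≤ ENNReal.ofReal C := fun n =>
    ENNReal.ofReal_le_ofReal ((le_abs_self _).trans (hC n))
  have hfin : ∀ s, 0 ≤ s → ∀ j, birthDeathLSemigroup β F s j ≠ ∞ := fun s hs j =>
    ne_top_of_le_ne_top ENNReal.ofReal_ne_top (birthDeathLSemigroup_le hβ hs hFC j)
  have hmeas : ∀ j, Measurable fun s => birthDeathLSemigroup β F (t - s) j := fun j =>
    (measurable_birthDeathLSemigroup β F j).comp (measurable_const.sub measurable_id)
  have hu := fun s (hs : 0 ≤ s) j => birthDeathSemigroup_eq_toReal hβ hs hf j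
  have hval := birthDeathLSemigroup_eq β F t m
  have hlt := hfin t ht m
  rw [hval] at hlt
  rw [hu t ht m]
  change (birthDeathLSemigroup β F t m).toReal = _
  rw [hval, ENNReal.toReal_add (ENNReal.add_ne_top.1 hlt).1 (ENNReal.add_ne_top.1 hlt).2,
    ENNReal.toReal_mul, ENNReal.toReal_ofReal (Real.exp_nonneg _), hF,
    ENNReal.toReal_ofReal (hf m), mul_add]
  congr 1
  rw [← integral_toReal]
  · have hsub := intervalIntegral.integral_comp_sub_left (a := 0) (b := t)
      (fun r => Real.exp (-(2 * m + β) * t) *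
        (Real.exp ((2 * m + β) * r) * ((m + β) * birthDeathSemigroup β r f (m + 1) +
          m * birthDeathSemigroup β r f (m - 1)))) t
    rw [sub_self, sub_zero] at hsub
    rw [← intervalIntegral.integral_const_mul, ← hsub,
      intervalIntegral.integral_of_le ht, ← integral_Icc_eq_integral_Ioc]
    refine setIntegral_congr_fun measurableSet_Icc fun s hs => ?_
    have hts : 0 ≤ t - s := sub_nonneg.2 hs.2
    have h1 := hfin _ hts (m + 1)
    have h2 := hfin _ hts (m - 1)
    rw [hu _ hts, hu _ hts, ENNReal.toReal_mul, ENNReal.toReal_add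
      (ENNReal.mul_ne_top ENNReal.ofReal_ne_top h1) (ENNReal.mul_ne_top ENNReal.ofReal_ne_top h2),
      ENNReal.toReal_mul, ENNReal.toReal_mul, ENNReal.toReal_ofReal (Real.exp_nonneg _),
      ENNReal.toReal_ofReal (by positivity), ENNReal.toReal_ofReal (by positivity), ← mul_assoc,
      ← Real.exp_add]
    congr 2
    ring
  · exact (Measurable.mul (by fun_prop)
      (((hmeas _).const_mul _).add ((hmeas _).const_mul _))).aemeasurable
  · refine (ae_restrict_iff' measurableSet_Icc).2 (ae_of_all _ fun s hs => ?_)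
    have hts : 0 ≤ t - s := sub_nonneg.2 hs.2
    exact ENNReal.mul_lt_top ENNReal.ofReal_lt_top (ENNReal.add_lt_top.2
      ⟨ENNReal.mul_lt_top ENNReal.ofReal_lt_top (hfin _ hts _).lt_top,
        ENNReal.mul_lt_top ENNReal.ofReal_lt_top (hfin _ hts _).lt_top⟩)

lemma isBackwardSolution_birthDeathSemigroup_of_nonneg {β : ℝ} (hβ : 0 ≤ β) {f : ℕ → ℝ} {C : ℝ}
    (hf : ∀ n, 0 ≤ f n) (hC : ∀ n, |f n| ≤ C) :
    IsBackwardSolution β f fun t => birthDeathSemigroup β t f := by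
  have hC0 : 0 ≤ C := (abs_nonneg _).trans (hC 0)
  have hmeas : ∀ j, Measurable fun r => birthDeathSemigroup β (max r 0) f j := by
    intro j
    simp_rw [birthDeathSemigroup_eq_toReal hβ (le_max_right _ (0 : ℝ)) hf]
    exact ((measurable_birthDeathLSemigroup β _ j).comp (by fun_prop)).ennreal_toReal
  let F : ℕ → ℝ → ℝ := fun m r => Real.exp ((2 * m + β) * r) *
    ((m + β) * birthDeathSemigroup β (max r 0) f (m + 1) +
      m * birthDeathSemigroup β (max r 0) f (m - 1))
  have hFm : ∀ m, Measurable (F m) := fun m => Measurable.mul (by fun_prop)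
    (((hmeas _).const_mul _).add ((hmeas _).const_mul _))
  have hFi : ∀ m a b, IntervalIntegrable (F m) volume a b := by
    intro m a b
    have hg : IntervalIntegrable (fun r : ℝ => Real.exp ((2 * m + β) * r) * ((2 * m + β) * C))
      volume a b := Continuous.intervalIntegrable (by fun_prop) _ _
    refine hg.mono_fun (hFm m).aestronglyMeasurable (ae_of_all _ fun r => ?_)
    simp only [F]
    rw [norm_mul, norm_mul]
    refine mul_le_mul_of_nonneg_left ?_ (norm_nonneg _)
    have h1 := abs_birthDeathSemigroup_le hβ (le_max_right r 0) hC (m + 1)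
    have h2 := abs_birthDeathSemigroup_le hβ (le_max_right r 0) hC (m - 1)
    rw [Real.norm_of_nonneg (show 0 ≤ (2 * m + β) * C by positivity)]
    refine (norm_add_le _ _).trans ?_
    rw [norm_mul, norm_mul, Real.norm_of_nonneg (show 0 ≤ (m : ℝ) + β by positivity),
      Real.norm_of_nonneg (show 0 ≤ (m : ℝ) by positivity), Real.norm_eq_abs, Real.norm_eq_abs]
    calc ((m : ℝ) + β) * _ + m * _ ≤ (m + β) * C + m * C := by gcongr
      _ = (2 * m + β) * C := by ring
  have heq : ∀ m, ∀ t ∈ Set.Ici (0 : ℝ), birthDeathSemigroup β t f m =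
      Real.exp (-(2 * m + β) * t) * (f m + ∫ r in (0 : ℝ)..t, F m r) := by
    intro m t ht
    rw [birthDeathSemigroup_eq_integral hβ ht hf hC]
    congr 2
    refine intervalIntegral.integral_congr fun r hr => ?_
    rw [Set.uIcc_of_le ht] at hr
    simp only [F, max_eq_left hr.1]
  have hcont : ∀ m, ContinuousOn (fun t => birthDeathSemigroup β t f m) (Set.Ici 0) := by
    intro m
    refine ContinuousOn.congr (Continuous.continuousOn ?_) (heq m)
    have := intervalIntegral.continuous_primitive (hFi m) 0
    fun_prop
  refine ⟨⟨C, fun t ht m => abs_birthDeathSemigroup_le hβ ht hC m⟩, hcont, fun m => ?_,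
    fun t ht m => ?_⟩
  · rw [heq m 0 (by simp)]; simp
  · have hct : ∀ j, ContinuousAt (fun r => birthDeathSemigroup β (max r 0) f j) t := by
      intro j
      refine ((hcont j).continuousAt (Ici_mem_nhds ht)).congr ?_
      filter_upwards [lt_mem_nhds ht] with r hr
      rw [max_eq_left hr.le]
    have hFc : ContinuousAt (F m) t := by
      have h1 := hct (m + 1)
      have h2 := hct (m - 1)
      simp only [F]
      fun_prop
    have h1 := intervalIntegral.integral_hasDerivAt_right (hFi m 0 t)
      (hFm m).stronglyMeasurable.stronglyMeasurableAtFilter hFc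
    have h2 : HasDerivAt (fun t : ℝ => Real.exp (-(2 * m + β) * t))
        (Real.exp (-(2 * m + β) * t) * -(2 * m + β)) t :=
      (((hasDerivAt_id' t).const_mul (-(2 * m + β))).exp).congr_deriv (by ring)
    refine ((h2.mul (h1.const_add (f m))).congr_of_eventuallyEq ?_).congr_deriv ?_
    · filter_upwards [lt_mem_nhds ht] with r hr
      exact heq m r hr.le
    · have h3 := heq m t ht.le
      have h4 : Real.exp (-(2 * m + β) * t) * Real.exp ((2 * m + β) * t) = 1 := by
        rw [← Real.exp_add, ← add_mul]; simp
      simp only [F, max_eq_left ht.le, birthDeathGenerator]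
      linear_combination (2 * m + β) * h3 + ((m + β) * birthDeathSemigroup β t f (m + 1) +
        m * birthDeathSemigroup β t f (m - 1)) * h4

/-- The semi-group applied to a bounded function solves the backward equation. -/
theorem isBackwardSolution_birthDeathSemigroup {β : ℝ} (hβ : 0 ≤ β) {f : ℕ → ℝ} {C : ℝ}
    (hC : ∀ n, |f n| ≤ C) : IsBackwardSolution β f fun t => birthDeathSemigroup β t f := by
  have h1 : ∀ n, |max (f n) 0| ≤ C := fun n => by
    rw [abs_of_nonneg (le_max_right _ _)]
    exact max_le ((le_abs_self _).trans (hC n)) ((abs_nonneg _).trans (hC n))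
  have h2 : ∀ n, |max (-f n) 0| ≤ C := fun n => by
    rw [abs_of_nonneg (le_max_right _ _)]
    exact max_le ((neg_le_abs _).trans (hC n)) ((abs_nonneg _).trans (hC n))
  have h := (isBackwardSolution_birthDeathSemigroup_of_nonneg hβ
    (fun n => le_max_right _ _) h1).sub
    (isBackwardSolution_birthDeathSemigroup_of_nonneg hβ (fun n => le_max_right _ _) h2)
  have hfun : f = (fun n => max (f n) 0) - fun n => max (-f n) 0 := by
    funext n
    rcases le_total (f n) 0 with h | h <;> simp [h]
  have heq : ∀ t, 0 ≤ t → ∀ m, birthDeathSemigroup β t f m =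
      birthDeathSemigroup β t (fun n => max (f n) 0) m -
        birthDeathSemigroup β t (fun n => max (-f n) 0) m := fun t ht m => by
    rw [← birthDeathSemigroup_sub hβ ht h1 h2, ← hfun]
  refine ⟨⟨C, fun t ht m => abs_birthDeathSemigroup_le hβ ht hC m⟩, fun m =>
    (h.continuousOn m).congr fun t ht => heq t ht m, fun m => ?_, fun t ht m => ?_⟩
  · rw [heq 0 le_rfl, h.initial, ← hfun]
  · rw [show birthDeathSemigroup β t f = fun m => birthDeathSemigroup β t (fun n => max (f n) 0) m -
        birthDeathSemigroup β t (fun n => max (-f n) 0) m from funext (heq t ht.le)]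
    refine (h.hasDerivAt t ht m).congr_of_eventuallyEq ?_
    filter_upwards [lt_mem_nhds ht] with r hr
    exact heq r hr.le m

/-! ### The maximum principle -/

lemma nonneg_of_hasDerivAt_of_le_left {g : ℝ → ℝ} {g' a t : ℝ} (hg : HasDerivAt g g' t)
    (hat : a < t) (h : ∀ s ∈ Set.Ioo a t, g s ≤ g t) : 0 ≤ g' := by
  have hlim := (hasDerivAt_iff_tendsto_slope_left_right.1 hg).1
  refine ge_of_tendsto hlim ?_
  filter_upwards [Ioo_mem_nhdsLT hat] with s hs
  rw [slope_def_field]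
  exact div_nonneg_of_nonpos (sub_nonpos.2 (h s hs)) (sub_nonpos.2 hs.2.le)

/-- A subsolution of the backward equation that is bounded above and starts below zero remains
below zero. -/
theorem subsolution_nonpos {β C : ℝ} (hβ : 0 ≤ β) {v v' : ℝ → ℕ → ℝ}
    (hC : ∀ t, 0 ≤ t → ∀ m, v t m ≤ C) (hcont : ∀ m, ContinuousOn (fun t => v t m) (Set.Ici 0))
    (h0 : ∀ m, v 0 m ≤ 0) (hderiv : ∀ t, 0 < t → ∀ m, HasDerivAt (fun t => v t m) (v' t m) t)
    (hle : ∀ t, 0 < t → ∀ m, v' t m ≤ birthDeathGenerator β (v t) m)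
    {t : ℝ} (ht : 0 ≤ t) (m : ℕ) : v t m ≤ 0 := by
  by_contra! hpos
  set V : ℝ → ℕ → ℝ := fun s j => ((j : ℝ) + 1) * Real.exp ((β + 1) * s) with hV
  have hV1 : ∀ s, 0 ≤ s → ∀ j : ℕ, (j : ℝ) + 1 ≤ V s j := fun s hs j =>
    le_mul_of_one_le_right (by positivity) (Real.one_le_exp (by positivity))
  obtain ⟨ε, hε, hεV⟩ : ∃ ε > 0, ε * V t m < v t m := by
    refine ⟨v t m / (2 * V t m), by positivity, ?_⟩
    have : 0 < V t m := by positivity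
    field_simp
    linarith
  obtain ⟨N, hN⟩ := exists_nat_gt (max (m : ℝ) (C / ε))
  have hmN : m ≤ N := by exact_mod_cast ((le_max_left _ _).trans_lt hN).le
  have hCN : C < ε * N := by
    have := (le_max_right _ _).trans_lt hN
    rwa [div_lt_iff₀' hε] at this
  set w : ℝ × ℕ → ℝ := fun p => v p.1 p.2 - ε * V p.1 p.2 with hw
  have hK : IsCompact (Set.Icc 0 t ×ˢ Set.Iic N) := isCompact_Icc.prod (Set.finite_Iic N).isCompact
  have hwc : ContinuousOn w (Set.Icc 0 t ×ˢ Set.Iic N) := by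
    refine continuousOn_prod_of_discrete_right.2 fun j => ?_
    refine ContinuousOn.sub ((hcont j).mono ?_) (Continuous.continuousOn (by fun_prop))
    exact fun s hs => hs.1.1
  obtain ⟨⟨s, j⟩, ⟨hs, hj⟩, hmax⟩ := hK.exists_isMaxOn ⟨(t, m), ⟨⟨ht, le_rfl⟩, hmN⟩⟩ hwc
  dsimp only at hs hj
  have hwpos : 0 < w (s, j) := lt_of_lt_of_le (sub_pos.2 hεV) (hmax (a := (t, m)) ⟨⟨ht, le_rfl⟩, hmN⟩)
  have hall : ∀ r ∈ Set.Icc 0 t, ∀ i, w (r, i) ≤ w (s, j) := by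
    intro r hr i
    rcases le_or_gt i N with hi | hi
    · exact hmax (a := (r, i)) ⟨hr, hi⟩
    · refine le_trans ?_ hwpos.le
      have h1 := hC r hr.1 i
      have h2 : ε * N ≤ ε * V r i := by
        have : (N : ℝ) < i := by exact_mod_cast hi
        exact mul_le_mul_of_nonneg_left (by linarith [hV1 r hr.1 i]) hε.le
      simp only [hw]
      linarith
  have hs0 : 0 < s := by
    refine lt_of_le_of_ne hs.1 fun h => ?_
    have h1 : 0 < ε * V s j := by positivity
    have h2 := h0 j
    rw [h] at h2
    simp only [hw] at hwpos
    linarith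
  have hVd : HasDerivAt (fun r => V r j) ((β + 1) * V s j) s :=
    ((((hasDerivAt_id' s).const_mul (β + 1)).exp).const_mul ((j : ℝ) + 1)).congr_deriv (by
      simp only [hV]; ring)
  have hd := nonneg_of_hasDerivAt_of_le_left ((hderiv s hs0 j).sub (hVd.const_mul ε)) hs0
    fun r hr => hall r ⟨hr.1.le, hr.2.le.trans hs.2⟩ j
  have hgen : birthDeathGenerator β (v s) j ≤ ε * (β * Real.exp ((β + 1) * s)) := by
    have h1 := hall s hs (j + 1)
    have h2 : (j : ℝ) * (w (s, j - 1) - w (s, j)) ≤ 0 :=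
      mul_nonpos_of_nonneg_of_nonpos (by positivity) (sub_nonpos.2 (hall s hs _))
    have h3 : ((j : ℝ) + β) * (w (s, j + 1) - w (s, j)) ≤ 0 :=
      mul_nonpos_of_nonneg_of_nonpos (by positivity) (sub_nonpos.2 h1)
    have h4 : (j : ℝ) * (V s (j - 1) - V s j) = - (j * Real.exp ((β + 1) * s)) := by
      rcases j with _ | j
      · simp
      · simp only [hV, Nat.add_sub_cancel]; push_cast; ring
    have h5 : V s (j + 1) - V s j = Real.exp ((β + 1) * s) := by
      simp only [hV]; push_cast; ring
    simp only [hw] at h2 h3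
    rw [birthDeathGenerator]
    linear_combination h2 + h3 + ε * h4 + ε * ((j : ℝ) + β) * h5
  have h1 := hle s hs0 j
  have h2 : β * Real.exp ((β + 1) * s) < (β + 1) * V s j := by
    have h3 := Real.exp_pos ((β + 1) * s)
    have h4 : 0 ≤ (β + 1) * (j * Real.exp ((β + 1) * s)) := by positivity
    simp only [hV]
    linarith
  have h3 := mul_lt_mul_of_pos_left h2 hε
  linarith

lemma IsBackwardSolution.le_zero {β : ℝ} (hβ : 0 ≤ β) {f : ℕ → ℝ} {u : ℝ → ℕ → ℝ}
    (hu : IsBackwardSolution β f u) (hf : ∀ m, f m ≤ 0) {t : ℝ} (ht : 0 ≤ t) (m : ℕ) :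
    u t m ≤ 0 := by
  obtain ⟨C, hC⟩ := hu.bounded
  exact subsolution_nonpos hβ (fun t ht m => (le_abs_self _).trans (hC t ht m)) hu.continuousOn
    (fun m => (hu.initial m).trans_le (hf m)) hu.hasDerivAt (fun _ _ _ => le_rfl) ht m

lemma IsBackwardSolution.unique {β : ℝ} (hβ : 0 ≤ β) {f : ℕ → ℝ} {u v : ℝ → ℕ → ℝ}
    (hu : IsBackwardSolution β f u) (hv : IsBackwardSolution β f v) {t : ℝ} (ht : 0 ≤ t) (m : ℕ) :
    u t m = v t m :=
  le_antisymm (sub_nonpos.1 ((hu.sub hv).le_zero hβ (by simp) ht m))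
    (sub_nonpos.1 ((hv.sub hu).le_zero hβ (by simp) ht m))

/-- A bound on the semi-group coming from the supersolution `ε + C exp t / (m + 2)`. -/
lemma birthDeathSemigroup_le_of_le {β ε C D : ℝ} (hβ : 0 ≤ β) (hε : 0 ≤ ε) (hC : 0 ≤ C)
    {f : ℕ → ℝ} (hD : ∀ n, |f n| ≤ D) (hf : ∀ n : ℕ, f n ≤ ε + C / (n + 2)) {t : ℝ} (ht : 0 ≤ t)
    (m : ℕ) : birthDeathSemigroup β t f m ≤ ε + C * Real.exp t / (m + 2) := by
  have hu := isBackwardSolution_birthDeathSemigroup hβ hD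
  have key := subsolution_nonpos (C := D) hβ
    (v := fun t m => birthDeathSemigroup β t f m - (ε + C * Real.exp t / (m + 2)))
    (v' := fun t m => birthDeathGenerator β (birthDeathSemigroup β t f) m -
      C * Real.exp t / (m + 2)) ?_ ?_ ?_ ?_ ?_ ht m
  · exact sub_nonpos.1 key
  · intro t ht m
    have h1 := (le_abs_self _).trans (abs_birthDeathSemigroup_le hβ ht hD m)
    have h2 : 0 ≤ C * Real.exp t / (m + 2) := by positivity
    linarith
  · exact fun m => (hu.continuousOn m).sub (Continuous.continuousOn (by fun_prop))
  · intro m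
    have h1 := hf m
    have h2 : birthDeathSemigroup β 0 f m = f m := hu.initial m
    simp only [h2, Real.exp_zero, mul_one]
    linarith
  · exact fun t ht m => (hu.hasDerivAt t ht m).sub
      ((((Real.hasDerivAt_exp t).const_mul C).div_const _).const_add ε)
  · intro t ht m
    set A := C * Real.exp t with hA
    have hA0 : 0 ≤ A := by positivity
    have h1 : A / (((m + 1 : ℕ) : ℝ) + 2) ≤ A / (m + 2) :=
      div_le_div_of_nonneg_left hA0 (by positivity) (by push_cast; linarith)
    have h2 : (m : ℝ) * (A / (((m - 1 : ℕ) : ℝ) + 2) - A / (m + 2)) ≤ A / (m + 2) := by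
      rcases m with _ | m
      · simp; positivity
      · simp only [Nat.add_sub_cancel]
        push_cast
        have : ((m : ℝ) + 1) * (A / (m + 2) - A / (m + 1 + 2)) =
            (m + 1) / (m + 2) * (A / (m + 1 + 2)) := by
          field_simp
          ring
        rw [this]
        refine mul_le_of_le_one_left (by positivity) ?_
        rw [div_le_one (by positivity)]
        linarith
    have h3 : ((m : ℝ) + β) * (A / (((m + 1 : ℕ) : ℝ) + 2) - A / (m + 2)) ≤ 0 :=
      mul_nonpos_of_nonneg_of_nonpos (by positivity) (sub_nonpos.2 h1)
    simp only [birthDeathGenerator]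
    linarith

lemma exists_le_add_div_of_tendsto_zero {f : ℕ → ℝ} (hf : Tendsto f atTop (𝓝 0)) {ε : ℝ}
    (hε : 0 < ε) : ∃ C, 0 ≤ C ∧ ∀ n : ℕ, |f n| ≤ ε + C / (n + 2) := by
  obtain ⟨N, hN⟩ := eventually_atTop.1 ((Metric.tendsto_nhds.1 hf) ε hε)
  refine ⟨∑ n ∈ Finset.range N, |f n| * (n + 2), Finset.sum_nonneg fun _ _ => by positivity,
    fun n => ?_⟩
  rcases lt_or_ge n N with h | h
  · have := Finset.single_le_sum (f := fun n : ℕ => |f n| * ((n : ℝ) + 2))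
      (fun _ _ => by positivity) (Finset.mem_range.2 h)
    have h2 : |f n| ≤ (∑ n ∈ Finset.range N, |f n| * ((n : ℝ) + 2)) / (n + 2) := by
      rw [le_div_iff₀ (by positivity)]
      exact this
    linarith
  · have := hN n h
    rw [Real.dist_eq, sub_zero] at this
    exact this.le.trans (le_add_of_nonneg_right (by positivity))

lemma exists_abs_le_of_tendsto_zero {f : ℕ → ℝ} (hf : Tendsto f atTop (𝓝 0)) :
    ∃ C, ∀ n, |f n| ≤ C := by
  obtain ⟨C, hC⟩ := hf.norm.bddAbove_range
  exact ⟨C, fun n => hC ⟨n, rfl⟩⟩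

lemma birthDeathSemigroup_neg (β t : ℝ) (f : ℕ → ℝ) (m : ℕ) :
    birthDeathSemigroup β t (-f) m = -birthDeathSemigroup β t f m := by
  simp [birthDeathSemigroup, tsum_neg]

/-- The semi-group preserves the functions vanishing at infinity. -/
theorem tendsto_birthDeathSemigroup {β t : ℝ} (hβ : 0 ≤ β) (ht : 0 ≤ t) {f : ℕ → ℝ}
    (hf : Tendsto f atTop (𝓝 0)) : Tendsto (birthDeathSemigroup β t f) atTop (𝓝 0) := by
  obtain ⟨D, hD⟩ := exists_abs_le_of_tendsto_zero hf
  rw [Metric.tendsto_atTop']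
  intro ε hε
  obtain ⟨C, hC0, hC⟩ := exists_le_add_div_of_tendsto_zero hf (half_pos hε)
  obtain ⟨N, hN⟩ := exists_nat_gt (C * Real.exp t / (ε / 2))
  refine ⟨N, fun m hm => ?_⟩
  have h1 := birthDeathSemigroup_le_of_le hβ (half_pos hε).le hC0 hD
    (fun n => (le_abs_self _).trans (hC n)) ht m
  have h2 := birthDeathSemigroup_le_of_le hβ (half_pos hε).le hC0 (f := -f) (by simpa using hD)
    (fun n => (neg_le_abs _).trans (hC n)) ht m
  rw [birthDeathSemigroup_neg] at h2
  have h3 : C * Real.exp t / (m + 2) < ε / 2 := by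
    rw [div_lt_iff₀ (half_pos hε)] at hN
    rw [div_lt_iff₀ (by positivity)]
    have : (N : ℝ) < m := by exact_mod_cast hm
    nlinarith
  rw [Real.dist_eq, sub_zero, abs_lt]
  constructor <;> linarith

/-! ### The discrete beta kernel -/

lemma beta_add_one_left {a b : ℝ} (ha : 0 < a) (hb : 0 < b) :
    (a + b) * beta (a + 1) b = a * beta a b := by
  have h1 := Real.Gamma_add_one ha.ne'
  have h2 := Real.Gamma_add_one (add_pos ha hb).ne'
  have h3 := (Real.Gamma_pos_of_pos (add_pos ha hb)).ne'
  have h4 := (add_pos ha hb).ne'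
  rw [beta, beta, h1, show a + 1 + b = a + b + 1 by ring, h2]
  field_simp

lemma beta_add_one_right {a b : ℝ} (ha : 0 < a) (hb : 0 < b) :
    (a + b) * beta a (b + 1) = b * beta a b := by
  have h1 := Real.Gamma_add_one hb.ne'
  have h2 := Real.Gamma_add_one (add_pos ha hb).ne'
  have h3 := (Real.Gamma_pos_of_pos (add_pos ha hb)).ne'
  have h4 := (add_pos ha hb).ne'
  rw [beta, beta, h1, ← add_assoc, h2]
  field_simp

lemma ae_mem_Ioo_betaMeasure (a b : ℝ) : ∀ᵐ r ∂(betaMeasure a b), r ∈ Set.Ioo (0 : ℝ) 1 := by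
  have hm : Measurable (betaPDF a b) := (measurable_betaPDFReal a b).ennreal_ofReal
  rw [betaMeasure, ae_withDensity_iff hm]
  refine ae_of_all _ fun r hr => ?_
  by_contra h
  exact hr (by rw [betaPDF_eq, if_neg (by exact h), ENNReal.ofReal_zero])

lemma lintegral_betaMeasure_pow_mul_pow {a b : ℝ} (ha : 0 < a) (hb : 0 < b) (i j : ℕ) :
    ∫⁻ r, ENNReal.ofReal (r ^ i * (1 - r) ^ j) ∂(betaMeasure a b) =
      ENNReal.ofReal (beta (a + i) (b + j) / beta a b) := by
  have h1 := beta_pos ha hb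
  have h2 : 0 < beta (a + i) (b + j) := beta_pos (by positivity) (by positivity)
  have h3 : ∫⁻ r, betaPDF (a + i) (b + j) r = 1 :=
    lintegral_betaPDF_eq_one (by positivity) (by positivity)
  have hm : ∀ a b, Measurable (betaPDF a b) := fun a b =>
    (measurable_betaPDFReal a b).ennreal_ofReal
  rw [betaMeasure, lintegral_withDensity_eq_lintegral_mul _ (hm a b) (by fun_prop),
    ← mul_one (ENNReal.ofReal _), ← h3, ← lintegral_const_mul _ (hm _ _)]
  refine lintegral_congr fun r => ?_
  by_cases hr : 0 < r ∧ r < 1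
  · have hr1 : 0 < 1 - r := sub_pos.2 hr.2
    simp only [Pi.mul_apply, betaPDF, betaPDFReal, if_pos hr]
    rw [← ENNReal.ofReal_mul' (by have := hr.1.le; positivity), ← ENNReal.ofReal_mul (by positivity)]
    congr 1
    rw [show a + i - 1 = a - 1 + i by ring, show b + j - 1 = b - 1 + j by ring,
      Real.rpow_add_natCast hr.1.ne', Real.rpow_add_natCast hr1.ne']
    field_simp
  · simp [betaPDF, betaPDFReal, if_neg hr]

lemma integral_betaMeasure_pow_mul_pow {a b : ℝ} (ha : 0 < a) (hb : 0 < b) (i j : ℕ) :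
    ∫ r, r ^ i * (1 - r) ^ j ∂(betaMeasure a b) = beta (a + i) (b + j) / beta a b := by
  rw [integral_eq_lintegral_of_nonneg_ae, lintegral_betaMeasure_pow_mul_pow ha hb,
    ENNReal.toReal_ofReal]
  · exact (div_pos (beta_pos (by positivity) (by positivity)) (beta_pos ha hb)).le
  · filter_upwards [ae_mem_Ioo_betaMeasure a b] with r hr
    have hr0 := hr.1
    have hr1 : 0 < 1 - r := sub_pos.2 hr.2
    simp only [Pi.zero_apply]
    positivity
  · exact Continuous.aestronglyMeasurable (by fun_prop)

/-- The weight `binom(n, m) * 𝔼[B ^ m * (1 - B) ^ (n - m)]` of the discrete beta kernel. -/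
noncomputable def discreteBetaWeight (β α : ℝ) (n m : ℕ) : ℝ :=
  n.choose m * (beta (β + m) (α + (n - m : ℕ)) / beta β α)

section

variable {α β : ℝ}

lemma discreteBetaKernel_eq (hα : 0 < α) (hβ : 0 < β) (g : ℕ → ℝ) (n : ℕ) :
    discreteBetaKernel β α g n =
      ∑ m ∈ Finset.range (n + 1), discreteBetaWeight β α n m * g m := by
  refine Finset.sum_congr rfl fun m _ => ?_
  rw [integral_betaMeasure_pow_mul_pow hβ hα, discreteBetaWeight]
  ring

lemma discreteBetaWeight_nonneg (hα : 0 < α) (hβ : 0 < β) (n m : ℕ) :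
    0 ≤ discreteBetaWeight β α n m :=
  mul_nonneg (by positivity)
    (div_pos (beta_pos (by positivity) (by positivity)) (beta_pos hβ hα)).le

lemma discreteBetaKernel_succ (hα : 0 < α) (hβ : 0 < β) (g : ℕ → ℝ) (n : ℕ) :
    (n + (α + β)) * discreteBetaKernel β α g (n + 1) =
      ∑ j ∈ Finset.range (n + 1),
        discreteBetaWeight β α n j * ((α + n - j) * g j + (β + j) * g (j + 1)) := by
  have hb := (beta_pos hβ hα).ne'
  have hsplit : discreteBetaKernel β α g (n + 1) =
      ∑ j ∈ Finset.range (n + 1), g (j + 1) * n.choose j *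
        (beta (β + j + 1) (α + (n - j : ℕ)) / beta β α) +
      ∑ j ∈ Finset.range (n + 1), g j * n.choose j *
        (beta (β + j) (α + (n - j : ℕ) + 1) / beta β α) := by
    have h : ∑ j ∈ Finset.range (n + 1), g j * n.choose j *
        (beta (β + j) (α + (n - j : ℕ) + 1) / beta β α) =
        ∑ j ∈ Finset.range (n + 1), g (j + 1) * n.choose (j + 1) *
        (beta (β + j + 1) (α + (n - j : ℕ)) / beta β α) + g 0 * (beta β (α + n + 1) / beta β α) := by
      have h1 := Finset.sum_range_succ (fun j => g j * n.choose j *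
        (beta (β + j) (α + (n + 1 - j : ℕ)) / beta β α)) (n + 1)
      rw [Finset.sum_range_succ'] at h1
      simp only [Nat.choose_succ_self, Nat.cast_zero, mul_zero, zero_mul, add_zero,
        Nat.choose_zero_right, Nat.cast_one, mul_one, Nat.sub_zero, Nat.add_sub_add_right] at h1
      calc _ = ∑ j ∈ Finset.range (n + 1), g j * n.choose j *
            (beta (β + j) (α + (n + 1 - j : ℕ)) / beta β α) := by
              refine Finset.sum_congr rfl fun j hj => ?_
              rw [Nat.succ_sub (Nat.lt_succ_iff.1 (Finset.mem_range.1 hj))]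
              push_cast
              rw [add_assoc α]
        _ = _ := by
              rw [← h1]
              push_cast
              simp only [add_assoc]
    rw [h, discreteBetaKernel_eq hα hβ, Finset.sum_range_succ', ← add_assoc,
      ← Finset.sum_add_distrib]
    congr 1
    · refine Finset.sum_congr rfl fun j _ => ?_
      rw [discreteBetaWeight, Nat.choose_succ_succ, Nat.add_sub_add_right]
      push_cast
      rw [← add_assoc β]
      ring
    · simp [discreteBetaWeight, add_assoc, mul_comm]
  rw [hsplit, ← Finset.sum_add_distrib, Finset.mul_sum]
  refine Finset.sum_congr rfl fun j hj => ?_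
  have hjn : j ≤ n := Nat.lt_succ_iff.1 (Finset.mem_range.1 hj)
  have h1 := beta_add_one_left (a := β + j) (b := α + (n - j : ℕ)) (by positivity) (by positivity)
  have h2 := beta_add_one_right (a := β + j) (b := α + (n - j : ℕ)) (by positivity) (by positivity)
  rw [discreteBetaWeight]
  rw [Nat.cast_sub hjn] at *
  field_simp
  linear_combination n.choose j * g (j + 1) * h1 + n.choose j * g j * h2

lemma discreteBetaKernel_pred (hα : 0 < α) (hβ : 0 < β) (g : ℕ → ℝ) (n : ℕ) :
    n * discreteBetaKernel β α g (n - 1) =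
      ∑ j ∈ Finset.range (n + 1),
        discreteBetaWeight β α n j * (j * g (j - 1) + (n - j) * g j) := by
  rcases n with _ | n
  · simp
  have hb := (beta_pos hβ hα).ne'
  simp only [mul_add, Finset.sum_add_distrib]
  rw [Finset.sum_range_succ', Finset.sum_range_succ (n := n + 1) (fun j => _ * (_ * g j)),
    sub_self, zero_mul, mul_zero, add_zero, Nat.cast_zero, zero_mul, mul_zero, add_zero,
    ← Finset.sum_add_distrib, Nat.add_sub_cancel, discreteBetaKernel_eq hα hβ, Finset.mul_sum]
  refine Finset.sum_congr rfl fun j hj => ?_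
  have hjn : j ≤ n := Nat.lt_succ_iff.1 (Finset.mem_range.1 hj)
  have h1 := beta_add_one_left (a := β + j) (b := α + (n - j : ℕ)) (by positivity) (by positivity)
  have h2 := beta_add_one_right (a := β + j) (b := α + (n - j : ℕ)) (by positivity) (by positivity)
  have h3 : ((n : ℝ) + 1) * n.choose j = (n + 1).choose (j + 1) * (j + 1) := by
    exact_mod_cast Nat.add_one_mul_choose_eq n j
  have h4 : (n.choose j : ℝ) * (n + 1) = (n + 1).choose j * (n + 1 - j) := by
    have := Nat.choose_mul_succ_eq n j
    rw [← @Nat.cast_inj ℝ] at this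
    push_cast [Nat.cast_sub (show j ≤ n + 1 by omega)] at this
    exact this
  have h5 : beta (β + j + 1) (α + (n - j : ℕ)) + beta (β + j) (α + (n - j : ℕ) + 1) =
      beta (β + j) (α + (n - j : ℕ)) := by
    have : (β + j + (α + (n - j : ℕ))) ≠ 0 := by positivity
    apply mul_left_cancel₀ this
    linear_combination h1 + h2
  simp only [discreteBetaWeight, Nat.add_sub_add_right, Nat.add_sub_cancel,
    Nat.succ_sub hjn]
  push_cast
  simp only [← add_assoc]
  rw [← h5]
  field_simp
  linear_combination g j * beta (β + j + 1) (α + (n - j : ℕ)) * h3 +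
    g j * beta (β + j) (α + (n - j : ℕ) + 1) * h4

/-- The discrete beta kernel intertwines the generators. -/
theorem birthDeathGenerator_discreteBetaKernel (hα : 0 < α) (hβ : 0 < β) (g : ℕ → ℝ) (n : ℕ) :
    birthDeathGenerator (α + β) (discreteBetaKernel β α g) n =
      discreteBetaKernel β α (birthDeathGenerator β g) n := by
  have h1 := discreteBetaKernel_succ hα hβ g n
  have h2 := discreteBetaKernel_pred hα hβ g n
  rw [birthDeathGenerator, mul_sub, mul_sub, h1, h2, discreteBetaKernel_eq hα hβ,
    discreteBetaKernel_eq hα hβ, Finset.mul_sum, Finset.mul_sum, ← Finset.sum_sub_distrib,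
    ← Finset.sum_sub_distrib, ← Finset.sum_add_distrib]
  refine Finset.sum_congr rfl fun j _ => ?_
  rw [birthDeathGenerator]
  ring

lemma sum_discreteBetaWeight (hα : 0 < α) (hβ : 0 < β) (n : ℕ) :
    ∑ m ∈ Finset.range (n + 1), discreteBetaWeight β α n m = 1 := by
  induction n with
  | zero => simp [discreteBetaWeight, (beta_pos hβ hα).ne']
  | succ n ih =>
    have h := discreteBetaKernel_succ hα hβ (fun _ => 1) n
    rw [discreteBetaKernel_eq hα hβ] at h
    simp only [mul_one] at h
    have hne : (n + (α + β) : ℝ) ≠ 0 := by positivity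
    apply mul_left_cancel₀ hne
    rw [h, mul_one, ← mul_one (n + (α + β) : ℝ), ← ih, Finset.mul_sum]
    exact Finset.sum_congr rfl fun j _ => by ring

lemma abs_discreteBetaKernel_le (hα : 0 < α) (hβ : 0 < β) {g : ℕ → ℝ} {C : ℝ}
    (hg : ∀ n, |g n| ≤ C) (n : ℕ) : |discreteBetaKernel β α g n| ≤ C := by
  rw [discreteBetaKernel_eq hα hβ]
  refine (Finset.abs_sum_le_sum_abs _ _).trans ?_
  calc _ ≤ ∑ m ∈ Finset.range (n + 1), discreteBetaWeight β α n m * C := by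
        refine Finset.sum_le_sum fun m _ => ?_
        rw [abs_mul, abs_of_nonneg (discreteBetaWeight_nonneg hα hβ n m)]
        exact mul_le_mul_of_nonneg_left (hg m) (discreteBetaWeight_nonneg hα hβ n m)
    _ = C := by rw [← Finset.sum_mul, sum_discreteBetaWeight hα hβ, one_mul]

lemma tendsto_choose_mul_pow_mul_pow {r : ℝ} (hr : r ∈ Set.Ioo (0 : ℝ) 1) (m : ℕ) :
    Tendsto (fun n : ℕ => n.choose m * (r ^ m * (1 - r) ^ (n - m))) atTop (𝓝 0) := by
  have hr0 := hr.1
  have hr1 : 0 < 1 - r := sub_pos.2 hr.2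
  have h := (tendsto_pow_const_mul_const_pow_of_abs_lt_one m (r := 1 - r)
    (by rw [abs_of_pos hr1]; linarith)).mul_const (r ^ m / (1 - r) ^ m)
  rw [zero_mul] at h
  refine squeeze_zero' (Eventually.of_forall fun n => by positivity) ?_ h
  filter_upwards [eventually_ge_atTop m] with n hn
  have h1 : (n.choose m : ℝ) ≤ (n : ℝ) ^ m := by exact_mod_cast Nat.choose_le_pow n m
  rw [pow_sub₀ _ hr1.ne' hn]
  calc _ = n.choose m * ((1 - r) ^ n * (r ^ m / (1 - r) ^ m)) := by rw [div_eq_mul_inv]; ring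
    _ ≤ (n : ℝ) ^ m * ((1 - r) ^ n * (r ^ m / (1 - r) ^ m)) :=
        mul_le_mul_of_nonneg_right h1 (by positivity)
    _ = _ := by ring

lemma choose_mul_pow_mul_pow_le_one {r : ℝ} (hr : r ∈ Set.Icc (0 : ℝ) 1) (n m : ℕ) :
    n.choose m * (r ^ m * (1 - r) ^ (n - m)) ≤ 1 := by
  have hr0 := hr.1
  have hr1 : 0 ≤ 1 - r := sub_nonneg.2 hr.2
  rcases lt_or_ge n m with h | h
  · simp [Nat.choose_eq_zero_of_lt h]
  · have h1 := add_pow r (1 - r) n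
    rw [add_sub_cancel, one_pow] at h1
    rw [mul_comm]
    refine le_of_le_of_eq ?_ h1.symm
    exact Finset.single_le_sum (f := fun m => r ^ m * (1 - r) ^ (n - m) * n.choose m)
      (fun _ _ => by positivity) (Finset.mem_range.2 (Nat.lt_succ_of_le h))

lemma tendsto_discreteBetaWeight (hα : 0 < α) (hβ : 0 < β) (m : ℕ) :
    Tendsto (fun n => discreteBetaWeight β α n m) atTop (𝓝 0) := by
  have := isProbabilityMeasureBeta hβ hα
  simp_rw [discreteBetaWeight, ← integral_betaMeasure_pow_mul_pow hβ hα, ← integral_const_mul]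
  rw [← integral_zero ℝ ℝ (μ := betaMeasure β α)]
  refine tendsto_integral_of_dominated_convergence (fun _ => 1)
    (fun n => Continuous.aestronglyMeasurable (by fun_prop)) (integrable_const _) (fun n => ?_) ?_
  · filter_upwards [ae_mem_Ioo_betaMeasure β α] with r hr
    have hr0 := hr.1
    have hr1 : 0 < 1 - r := sub_pos.2 hr.2
    rw [Real.norm_of_nonneg (by positivity)]
    exact choose_mul_pow_mul_pow_le_one ⟨hr.1.le, hr.2.le⟩ n m
  · filter_upwards [ae_mem_Ioo_betaMeasure β α] with r hr
    exact tendsto_choose_mul_pow_mul_pow hr m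

/-- The discrete beta kernel preserves the functions vanishing at infinity. -/
theorem tendsto_discreteBetaKernel (hα : 0 < α) (hβ : 0 < β) {f : ℕ → ℝ}
    (hf : Tendsto f atTop (𝓝 0)) : Tendsto (discreteBetaKernel β α f) atTop (𝓝 0) := by
  obtain ⟨D, hD⟩ := exists_abs_le_of_tendsto_zero hf
  have hD0 : 0 ≤ D := (abs_nonneg _).trans (hD 0)
  rw [Metric.tendsto_nhds]
  intro ε hε
  obtain ⟨N, hN⟩ := eventually_atTop.1 ((Metric.tendsto_nhds.1 hf) (ε / 2) (half_pos hε))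
  have hlim : Tendsto (fun n => D * ∑ m ∈ Finset.range N, discreteBetaWeight β α n m) atTop
      (𝓝 0) := by
    have := (tendsto_finsetSum (Finset.range N) fun m _ =>
      tendsto_discreteBetaWeight hα hβ m).const_mul D
    simpa using this
  filter_upwards [(tendsto_order.1 hlim).2 _ (half_pos hε)] with n hn
  have hw := discreteBetaWeight_nonneg hα hβ n
  rw [Real.dist_eq, sub_zero, discreteBetaKernel_eq hα hβ]
  calc _ ≤ ∑ m ∈ Finset.range (n + 1), |discreteBetaWeight β α n m * f m| :=
        Finset.abs_sum_le_sum_abs _ _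
    _ ≤ ∑ m ∈ Finset.range (n + 1), (discreteBetaWeight β α n m * (ε / 2) +
          if m < N then D * discreteBetaWeight β α n m else 0) := by
        refine Finset.sum_le_sum fun m _ => ?_
        rw [abs_mul, abs_of_nonneg (hw m)]
        split_ifs with h
        · have h1 := mul_le_mul_of_nonneg_left (hD m) (hw m)
          have h2 := mul_nonneg (hw m) (half_pos hε).le
          linarith
        · have h1 := hN m (not_lt.1 h)
          rw [Real.dist_eq, sub_zero] at h1
          rw [add_zero]
          exact mul_le_mul_of_nonneg_left h1.le (hw m)
    _ ≤ ε / 2 + D * ∑ m ∈ Finset.range N, discreteBetaWeight β α n m := by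
        rw [Finset.sum_add_distrib, ← Finset.sum_mul, sum_discreteBetaWeight hα hβ, one_mul,
          ← Finset.sum_filter, Finset.mul_sum]
        refine add_le_add_right (Finset.sum_le_sum_of_subset_of_nonneg (fun m hm => ?_)
          fun m _ _ => mul_nonneg hD0 (hw m)) _
        exact Finset.mem_range.2 (Finset.mem_filter.1 hm).2
    _ < ε := by linarith

lemma IsBackwardSolution.discreteBetaKernel (hα : 0 < α) (hβ : 0 < β) {f : ℕ → ℝ}
    {u : ℝ → ℕ → ℝ} (hu : IsBackwardSolution β f u) :
    IsBackwardSolution (α + β) (_root_.discreteBetaKernel β α f)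
      fun t => _root_.discreteBetaKernel β α (u t) where
  bounded := by
    obtain ⟨C, hC⟩ := hu.bounded
    exact ⟨C, fun t ht m => abs_discreteBetaKernel_le hα hβ (hC t ht) m⟩
  continuousOn n := by
    simp_rw [discreteBetaKernel_eq hα hβ]
    exact continuousOn_finsetSum _ fun m _ => (hu.continuousOn m).const_mul _
  initial n := by rw [show u 0 = f from funext hu.initial]
  hasDerivAt t ht n := by
    rw [birthDeathGenerator_discreteBetaKernel hα hβ]
    simp_rw [discreteBetaKernel_eq hα hβ]
    exact HasDerivAt.fun_sum fun m _ => (hu.hasDerivAt t ht m).const_mul _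

/-- The discrete beta kernel intertwines the semi-groups on bounded functions. -/
theorem birthDeathSemigroup_discreteBetaKernel (hα : 0 < α) (hβ : 0 < β) {f : ℕ → ℝ} {C : ℝ}
    (hf : ∀ n, |f n| ≤ C) {t : ℝ} (ht : 0 ≤ t) :
    birthDeathSemigroup (α + β) t (discreteBetaKernel β α f) =
      discreteBetaKernel β α (birthDeathSemigroup β t f) := by
  funext n
  exact (isBackwardSolution_birthDeathSemigroup (add_pos hα hβ).le
    (abs_discreteBetaKernel_le hα hβ hf)).unique (add_pos hα hβ).le
    ((isBackwardSolution_birthDeathSemigroup hβ.le hf).discreteBetaKernel hα hβ) ht n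

end

/-! ### Binomial thinning of mixed Poisson laws -/

lemma measurable_measure_of_singleton {Ω : Type*} [MeasurableSpace Ω] {κ : Ω → Measure ℕ}
    (h : ∀ k, Measurable fun ω => κ ω {k}) : Measurable κ := by
  refine Measure.measurable_of_measurable_coe _ fun s hs => ?_
  simp_rw [← Measure.tsum_indicator_apply_singleton _ s hs]
  refine Measurable.tsum fun k => ?_
  by_cases hk : k ∈ s
  · simpa [hk] using h k
  · simp [hk]

lemma map_sum_infinitePi_bernoulliMeasure_succ (p : unitInterval) (n : ℕ) :
    (Measure.infinitePi fun _ : ℕ => bernoulliMeasure (1 : ℕ) 0 p).map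
        (fun x => ∑ i ∈ Finset.range (n + 1), x i) =
      (bernoulliMeasure (1 : ℕ) 0 p).conv
        ((Measure.infinitePi fun _ : ℕ => bernoulliMeasure (1 : ℕ) 0 p).map
          (fun x => ∑ i ∈ Finset.range n, x i)) := by
  set μ := Measure.infinitePi fun _ : ℕ => bernoulliMeasure (1 : ℕ) 0 p with hμ
  have hind : iIndepFun (fun i (x : ℕ → ℕ) => x i) μ :=
    iIndepFun_infinitePi (X := fun _ x => x) fun _ => measurable_id
  have h := (hind.indepFun_sum_range_succ (fun i => measurable_pi_apply i) n).map_add_eq_map_conv_map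
    (by fun_prop) (measurable_pi_apply n)
  rw [hμ, Measure.infinitePi_map_eval, ← hμ, Measure.conv_comm] at h
  have h1 : ∀ k, (∑ j ∈ Finset.range k, fun x : ℕ → ℕ => x j) =
      fun x => ∑ j ∈ Finset.range k, x j := fun k => by
    funext x
    simp
  rw [h1] at h
  rw [← h]
  congr 1
  funext x
  exact Finset.sum_range_succ _ _

lemma map_sum_infinitePi_bernoulliMeasure_singleton (p : unitInterval) (n k : ℕ) :
    (Measure.infinitePi fun _ : ℕ => bernoulliMeasure (1 : ℕ) 0 p).map
        (fun x => ∑ i ∈ Finset.range n, x i) {k} =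
      ENNReal.ofReal (n.choose k * ((p : ℝ) ^ k * (1 - p) ^ (n - k))) := by
  induction n generalizing k with
  | zero =>
    rcases k with _ | k <;> simp
  | succ n ih =>
    have hp0 := p.2.1
    have hp1 : (0 : ℝ) ≤ 1 - p := sub_nonneg.2 p.2.2
    have hB : bernoulliMeasure (1 : ℕ) 0 p = ENNReal.ofReal p • Measure.dirac 1 +
        ENNReal.ofReal (1 - p) • Measure.dirac 0 := by
      have e : ∀ q : unitInterval, ENNReal.ofReal q = (unitInterval.toNNReal q : ℝ≥0∞) :=
        fun q => ENNReal.ofReal_eq_coe_nnreal q.2.1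
      rw [bernoulliMeasure_def, e p, ← unitInterval.coe_symm_eq p, e]
      rfl
    rw [map_sum_infinitePi_bernoulliMeasure_succ]
    have hfin : SFinite ((Measure.infinitePi fun _ : ℕ => bernoulliMeasure (1 : ℕ) 0 p).map
        (fun x => ∑ i ∈ Finset.range n, x i)) := inferInstance
    generalize (Measure.infinitePi fun _ : ℕ => bernoulliMeasure (1 : ℕ) 0 p).map
        (fun x => ∑ i ∈ Finset.range n, x i) = ρ at ih hfin ⊢
    rw [hB, Measure.add_conv, Measure.conv_smul_left,
      Measure.conv_smul_left, Measure.dirac_conv, Measure.dirac_conv]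
    rw [Measure.add_apply, Measure.smul_apply, Measure.smul_apply,
      Measure.map_apply (by fun_prop) (measurableSet_singleton k),
      Measure.map_apply (by fun_prop) (measurableSet_singleton k)]
    have h0 : (fun y => 0 + y) ⁻¹' {k} = {k} := by ext; simp
    rw [h0, ih]
    rcases k with _ | k
    · have h1 : (fun y => 1 + y) ⁻¹' {0} = (∅ : Set ℕ) := by ext; simp
      rw [h1]
      simp only [measure_empty, smul_eq_mul, mul_zero, zero_add]
      rw [← ENNReal.ofReal_mul hp1]
      simp [pow_succ']
    · have h1 : (fun y => 1 + y) ⁻¹' {k + 1} = {k} := by ext; simp; omega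
      rw [h1, ih, smul_eq_mul, smul_eq_mul, ← ENNReal.ofReal_mul hp0, ← ENNReal.ofReal_mul hp1,
        ← ENNReal.ofReal_add (by positivity) (by positivity)]
      congr 1
      rw [Nat.choose_succ_succ, Nat.add_sub_add_right]
      rcases lt_or_ge k n with h | h
      · rw [show n - k = n - (k + 1) + 1 by omega]
        push_cast
        ring
      · rw [Nat.choose_eq_zero_of_lt (show n < k + 1 by omega)]
        push_cast
        ring

lemma thinningLaw_singleton (p : unitInterval) (ν : Measure ℕ) [SFinite ν] (k : ℕ) :
    thinningLaw p ν {k} =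
      ∑' n, ENNReal.ofReal (n.choose k * ((p : ℝ) ^ k * (1 - p) ^ (n - k))) * ν {n} := by
  have hm : Measurable fun x : ℕ × (ℕ → ℕ) => ∑ i ∈ Finset.range x.1, x.2 i :=
    measurable_from_prod_countable_right fun n =>
      Finset.measurable_sum (Finset.range n) fun i _ => measurable_pi_apply i
  rw [thinningLaw, Measure.map_apply hm (measurableSet_singleton k),
    Measure.prod_apply (hm (measurableSet_singleton k)), lintegral_countable']
  refine tsum_congr fun n => ?_
  rw [← map_sum_infinitePi_bernoulliMeasure_singleton,
    Measure.map_apply (by fun_prop) (measurableSet_singleton k)]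
  rfl

lemma randomThinningLaw_singleton {ρ : Measure ℝ} (hρ : ∀ᵐ r ∂ρ, r ∈ Set.Ioo (0 : ℝ) 1)
    (ν : Measure ℕ) [SFinite ν] (k : ℕ) :
    randomThinningLaw ρ ν {k} = ∑' n, ENNReal.ofReal (n.choose k) *
      (∫⁻ r, ENNReal.ofReal (r ^ k * (1 - r) ^ (n - k)) ∂ρ) * ν {n} := by
  have hm : Measurable fun r : ℝ => thinningLaw (Set.projIcc 0 1 zero_le_one r) ν := by
    refine measurable_measure_of_singleton fun k => ?_
    simp_rw [thinningLaw_singleton]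
    have : Measurable fun r : ℝ => ((Set.projIcc (0 : ℝ) 1 zero_le_one r : unitInterval) : ℝ) :=
      (continuous_subtype_val.comp continuous_projIcc).measurable
    exact Measurable.tsum fun n => by fun_prop
  rw [randomThinningLaw, Measure.bind_apply (measurableSet_singleton k) hm.aemeasurable]
  have h : ∀ᵐ r ∂ρ, thinningLaw (Set.projIcc 0 1 zero_le_one r) ν {k} =
      ∑' n, ENNReal.ofReal (n.choose k) * ENNReal.ofReal (r ^ k * (1 - r) ^ (n - k)) * ν {n} := by
    filter_upwards [hρ] with r hr
    rw [thinningLaw_singleton, Set.projIcc_of_mem _ ⟨hr.1.le, hr.2.le⟩]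
    simp_rw [ENNReal.ofReal_mul (Nat.cast_nonneg _)]
  rw [lintegral_congr_ae h, lintegral_tsum fun n => by fun_prop]
  refine tsum_congr fun n => ?_
  rw [lintegral_mul_const _ (by fun_prop), lintegral_const_mul _ (by fun_prop)]

lemma measurable_poissonMeasure_toNNReal :
    Measurable fun x : ℝ => poissonMeasure x.toNNReal := by
  refine measurable_measure_of_singleton fun k => ?_
  simp_rw [poissonMeasure_singleton]
  fun_prop

lemma poissonGammaLaw_singleton {a : ℝ} (ha : 0 < a) (n : ℕ) :
    poissonGammaLaw a {n} = ENNReal.ofReal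
      (Real.Gamma (a + n) / (Real.Gamma a * n.factorial * 2 ^ (a + n))) := by
  have hm : ∀ a r, Measurable (gammaPDF a r) := fun a r =>
    (measurable_gammaPDFReal a r).ennreal_ofReal
  have han : 0 < a + n := by positivity
  have hG := Real.Gamma_pos_of_pos ha
  have hGn := Real.Gamma_pos_of_pos han
  have h2 : (0 : ℝ) < 2 ^ (a + n) := by positivity
  rw [poissonGammaLaw, Measure.bind_apply (measurableSet_singleton n)
    measurable_poissonMeasure_toNNReal.aemeasurable]
  simp_rw [poissonMeasure_singleton]
  rw [gammaMeasure, lintegral_withDensity_eq_lintegral_mul _ (hm a 1) (by fun_prop),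
    ← mul_one (ENNReal.ofReal (_ / _)), ← lintegral_gammaPDF_eq_one han (zero_lt_two' ℝ),
    ← lintegral_const_mul _ (hm _ _)]
  refine lintegral_congr_ae ?_
  filter_upwards [compl_mem_ae_iff.2 (measure_singleton (0 : ℝ))] with x hx
  rcases lt_or_gt_of_ne hx with hx | hx
  · simp [gammaPDF_of_neg hx]
  · simp only [Pi.mul_apply, gammaPDF_of_nonneg hx.le]
    rw [← ENNReal.ofReal_mul (by positivity), ← ENNReal.ofReal_mul (by positivity)]
    congr 1
    rw [Real.coe_toNNReal _ hx.le, show a + n - 1 = a - 1 + n by ring,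
      Real.rpow_add_natCast hx.ne', Real.one_rpow, one_mul,
      show -(2 * x) = -x + -x by ring, Real.exp_add]
    field_simp

lemma isProbabilityMeasure_poissonGammaLaw {a : ℝ} (ha : 0 < a) :
    IsProbabilityMeasure (poissonGammaLaw a) := by
  have := isProbabilityMeasure_gammaMeasure ha one_pos
  refine ⟨?_⟩
  rw [poissonGammaLaw, Measure.bind_apply MeasurableSet.univ
    measurable_poissonMeasure_toNNReal.aemeasurable]
  simp

lemma ofReal_discreteBetaWeight_mul_poissonGammaLaw {α β : ℝ} (hα : 0 < α) (hβ : 0 < β)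
    (i j : ℕ) :
    ENNReal.ofReal (discreteBetaWeight β α (i + j) j) * poissonGammaLaw (α + β) {i + j} =
      poissonGammaLaw β {j} * poissonGammaLaw α {i} := by
  have hS := add_pos hα hβ
  have hSn : 0 < α + β + (i + j : ℕ) := by positivity
  have h1 := Real.Gamma_pos_of_pos hα
  have h2 := Real.Gamma_pos_of_pos hβ
  have h3 := Real.Gamma_pos_of_pos hS
  have h4 := Real.Gamma_pos_of_pos hSn
  have h5 : 0 < Real.Gamma (β + j) := Real.Gamma_pos_of_pos (by positivity)
  rw [poissonGammaLaw_singleton hα, poissonGammaLaw_singleton hβ, poissonGammaLaw_singleton hS,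
    ← ENNReal.ofReal_mul (discreteBetaWeight_nonneg hα hβ _ _),
    ← ENNReal.ofReal_mul (by positivity)]
  congr 1
  have h6 : ((i + j).choose j : ℝ) * i.factorial * j.factorial = (i + j).factorial := by
    rw [add_comm i j]
    have := Nat.add_choose_mul_factorial_mul_factorial j i
    rw [← this, ← Nat.choose_symm_add]
    push_cast
    ring
  have h7 : (2 : ℝ) ^ (α + β + (i + j : ℕ)) = 2 ^ (β + j) * 2 ^ (α + i) := by
    rw [← Real.rpow_add two_pos]
    push_cast
    congr 1
    ring
  rw [discreteBetaWeight, beta, beta, Nat.add_sub_cancel, h7, ← h6,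
    show β + j + (α + i) = α + β + (i + j : ℕ) by push_cast; ring, add_comm β α]
  have h8 : ((i + j).choose j : ℝ) ≠ 0 := by
    exact_mod_cast (Nat.choose_pos (Nat.le_add_left j i)).ne'
  field_simp

/-- The beta thinning of a `Pois(Gam(α + β))` law is the `Pois(Gam(β))` law. -/
theorem randomThinningLaw_betaMeasure_poissonGammaLaw {α β : ℝ} (hα : 0 < α) (hβ : 0 < β) :
    randomThinningLaw (betaMeasure β α) (poissonGammaLaw (α + β)) = poissonGammaLaw β := by
  have := isProbabilityMeasure_poissonGammaLaw (add_pos hα hβ)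
  have := isProbabilityMeasure_poissonGammaLaw hα
  refine Measure.ext_of_singleton fun j => ?_
  rw [randomThinningLaw_singleton (ae_mem_Ioo_betaMeasure β α)]
  simp_rw [lintegral_betaMeasure_pow_mul_pow hβ hα, ← ENNReal.ofReal_mul (Nat.cast_nonneg _)]
  change ∑' n, ENNReal.ofReal (discreteBetaWeight β α n j) * poissonGammaLaw (α + β) {n} = _
  rw [← Summable.sum_add_tsum_nat_add' (k := j) ENNReal.summable, Finset.sum_eq_zero, zero_add]
  · simp_rw [ofReal_discreteBetaWeight_mul_poissonGammaLaw hα hβ]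
    rw [ENNReal.tsum_mul_left]
    have h := lintegral_countable' (μ := poissonGammaLaw α) fun _ => 1
    simp only [lintegral_one, measure_univ, one_mul] at h
    rw [← h, mul_one]
  · intro n hn
    simp [discreteBetaWeight, Nat.choose_eq_zero_of_lt (Finset.mem_range.1 hn)]

theorem proposition2 (α β : ℝ) (hα : 0 < α) (hβ : 0 < β) :
    (∀ t : ℝ, 0 < t → ∀ f : C₀(ℕ, ℝ),
      Tendsto (discreteBetaKernel β α f) atTop (𝓝 0) ∧
      Tendsto (birthDeathSemigroup (α + β) t f) atTop (𝓝 0) ∧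
      Tendsto (birthDeathSemigroup β t f) atTop (𝓝 0) ∧
      birthDeathSemigroup (α + β) t (discreteBetaKernel β α f) =
        discreteBetaKernel β α (birthDeathSemigroup β t f)) ∧
    randomThinningLaw (betaMeasure β α) (poissonGammaLaw (α + β)) = poissonGammaLaw β := by
  refine ⟨fun t ht f => ?_, randomThinningLaw_betaMeasure_poissonGammaLaw hα hβ⟩
  have hf : Tendsto f atTop (𝓝 0) := by
    have := f.zero_at_infty'
    rwa [cocompact_eq_cofinite, Nat.cofinite_eq_atTop] at this
  obtain ⟨C, hC⟩ := exists_abs_le_of_tendsto_zero hf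
  exact ⟨tendsto_discreteBetaKernel hα hβ hf,
    tendsto_birthDeathSemigroup (add_pos hα hβ).le ht.le hf,
    tendsto_birthDeathSemigroup hβ.le ht.le hf,
    birthDeathSemigroup_discreteBetaKernel hα hβ hC ht.le⟩
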